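/- Let $\rho,\tau_g,\tau_r\in(0,1)$ and let $n,w\ge 1$ be integers. Consider a ring of $n$ nodes, numbered modulo $n$. Initially each node is, independently, green with probability $\rho$ and red with probability $1-\rho$. The neighbourhood of a node $x$ is $\mathcal N(x)=[x-w,x+w]$ (mod $n$). A green (respectively red) node $x$ is happy if $\mathcal N(x)$ contains at least $\tau_g(2w+1)$ green (respectively at least $\tau_r(2w+1)$ red) nodes, and unhappy otherwise; an unhappy node is hopeful if changing its colour would make it happy. The ring evolves in discrete time by one of three dynamics. Selective: at each step a hopeful node chosen uniformly at random changes colour. Incremental: at each step an unhappy node chosen uniformly at random changes colour. Synchronous: at each step all unhappy nodes change colour. The process stops (the ring has finished) when no further change is possible. For $0<s<\frac12$ let $f(s)=\dfrac{(\frac12-s)^{1-2s}}{(1-s)^{2(1-s)}}$. This is strictly increasing from $\frac12$ (as $s\to0$) to $2$ (as $s\to\frac12$). Let $\kappa^\rho_g$ be the unique root in $(0,\frac12)$ of $f(s)=\frac{1}{2(1-\rho)}$ if $\rho<\frac34$, and $\kappa^\rho_g=\frac12$ if $\rho\ge\frac34$. Let $\kappa^\rho_r$ be the unique root in $(0,\frac12)$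 of $f(s)=\frac1{2\rho}$ if $\rho>\frac14$, and $\kappa^\rho_r=\frac12$ if $\rho\le\frac14$. Theorem. Suppose that $\tau_g<\kappa^\rho_g$ and $\tau_r<\kappa^\rho_r$. Then under each of the three dynamics the scenario $(\rho,\tau_g,\tau_r)$ is static almost everywhere: for every $\varepsilon>0$ there is $W$ such that for every $w\ge W$ there is $N$ such that for every $n\ge N$, a node chosen uniformly at random (independently of the process) has probability less than $\varepsilon$ of changing colour at any stage before the ring finishes (at any stage at all, if it never finishes). -/

import Mathlib

open MeasureTheory ProbabilityTheory

noncomputable section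

namespace Schelling

/-! ### The model -/

/-- The two races: `true` is green and `false` is red. -/
abbrev Colour : Type := Bool

abbrev green : Colour := true

abbrev red : Colour := false

/-- A colouring of the ring, whose nodes are the residues modulo `n`. -/
abbrev Colouring (n : ℕ) : Type := ZMod n → Colour

/-- The neighbourhood `[x - w, x + w]` of the node `x`, understood modulo `n`. -/
def neighbourhood {n : ℕ} (w : ℕ) (x : ZMod n) : Finset (ZMod n) :=
  (Finset.Icc (-(w : ℤ)) (w : ℤ)).image fun i : ℤ => x + (i : ZMod n)

/-- The tolerance parameter of a colour. -/
def tolerance (τg τr : ℝ) : Colour → ℝ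
  | true => τg
  | false => τr

/-- The node `x` is happy if its neighbourhood contains at least `τ * (2 * w + 1)` nodes of the
colour of `x`, where `τ` is the parameter of that colour. -/
def Happy {n : ℕ} (w : ℕ) (τg τr : ℝ) (c : Colouring n) (x : ZMod n) : Prop :=
  tolerance τg τr (c x) * (2 * (w : ℝ) + 1) ≤
    (((neighbourhood w x).filter fun y => c y = c x).card : ℝ)

/-- The colouring obtained from `c` by changing the colour of the node `x` only. -/
def recolour {n : ℕ} (c : Colouring n) (x : ZMod n) : Colouring n :=
  Function.update c x (!c x)

/-- The node `x` is hopeful if it is unhappy, and changing its colour would make it happy. -/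
def Hopeful {n : ℕ} (w : ℕ) (τg τr : ℝ) (c : Colouring n) (x : ZMod n) : Prop :=
  ¬ Happy w τg τr c x ∧ Happy w τg τr (recolour c x) x

/-- The three dynamics by which the ring may evolve. -/
inductive Dynamics : Type
  | selective
  | incremental
  | synchronous

/-- Recolour one node of `s`, selected uniformly at random; if `s` is empty, nothing changes. -/
def recolourRandom {n : ℕ} (c : Colouring n) (s : Finset (ZMod n)) : PMF (Colouring n) :=
  open Classical in
  if h : s.Nonempty then (PMF.uniformOfFinset s h).map (recolour c) else PMF.pure c

/-- The distribution of the next colouring, given the current one. In the selective dynamic a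
uniformly random hopeful node changes colour, in the incremental dynamic a uniformly random unhappy
node does, and in the synchronous dynamic all unhappy nodes do. When there is no such node, the
ring has finished, and the colouring remains the same forever. -/
def nextColouring {n : ℕ} [NeZero n] (w : ℕ) (τg τr : ℝ) (d : Dynamics) (c : Colouring n) :
    PMF (Colouring n) :=
  open Classical in
  match d with
  | .selective => recolourRandom c (Finset.univ.filter fun x => Hopeful w τg τr c x)
  | .incremental => recolourRandom c (Finset.univ.filter fun x => ¬ Happy w τg τr c x)
  | .synchronous => PMF.pure fun x => if Happy w τg τr c x then c x else !c x

/-- The transition kernel of the Markov chain of colourings. -/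
def stepKernel {n : ℕ} [NeZero n] (w : ℕ) (τg τr : ℝ) (d : Dynamics) :
    Kernel (Colouring n) (Colouring n) :=
  Kernel.ofFunOfCountable fun c => (nextColouring w τg τr d c).toMeasure

instance {n : ℕ} [NeZero n] (w : ℕ) (τg τr : ℝ) (d : Dynamics) :
    IsMarkovKernel (stepKernel (n := n) w τg τr d) :=
  ⟨fun c => by
    change IsProbabilityMeasure (nextColouring w τg τr d c).toMeasure
    infer_instance⟩

/-- The same transition kernel, as a function of the whole history up to time `t`. -/
def historyKernel {n : ℕ} [NeZero n] (w : ℕ) (τg τr : ℝ) (d : Dynamics) (t : ℕ) :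
    Kernel ((_ : Finset.Iic t) → Colouring n) (Colouring n) :=
  (stepKernel w τg τr d).comap (fun h => h ⟨t, Finset.mem_Iic.2 le_rfl⟩) (measurable_pi_apply _)

instance {n : ℕ} [NeZero n] (w : ℕ) (τg τr : ℝ) (d : Dynamics) (t : ℕ) :
    IsMarkovKernel (historyKernel (n := n) w τg τr d t) := by
  unfold historyKernel
  infer_instance

/-- The biased coin: green with probability `ρ` and red with probability `1 - ρ`. -/
def coin (ρ : ℝ) : Measure Colour :=
  ENNReal.ofReal ρ • Measure.dirac green + ENNReal.ofReal (1 - ρ) • Measure.dirac red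

/-- The law of the initial colouring, in which the nodes are coloured by independent coins. -/
def initialLaw (n : ℕ) [NeZero n] (ρ : ℝ) : Measure (Colouring n) :=
  Measure.pi fun _ => coin ρ

/-- The law of the process: the Markov chain started from `initialLaw`, evolving by `stepKernel`. -/
def processLaw (n : ℕ) [NeZero n] (w : ℕ) (ρ τg τr : ℝ) (d : Dynamics) :
    Measure (ℕ → Colouring n) :=
  Kernel.trajMeasure (X := fun _ => Colouring n) (initialLaw n ρ) (historyKernel w τg τr d)

/-- The joint law of a uniformly random node and, independently of it, the process. -/
def nodeAndProcessLaw (n : ℕ) [NeZero n] (w : ℕ) (ρ τg τr : ℝ) (d : Dynamics) :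
    Measure (ZMod n × (ℕ → Colouring n)) :=
  (PMF.uniformOfFintype (ZMod n)).toMeasure.prod (processLaw n w ρ τg τr d)

/-- The event that the random node changes colour at some stage. (Once the ring has finished, no
node changes any more, so that such a stage is before the ring finishes.) -/
def changesColour (n : ℕ) : Set (ZMod n × (ℕ → Colouring n)) :=
  {p | ∃ t : ℕ, p.2 (t + 1) p.1 ≠ p.2 t p.1}

/-- The scenario `(ρ, τg, τr)` is static almost everywhere: for every `ε > 0`, for all sufficiently
large `w` and all `n` sufficiently large compared to `w`, a uniformly random node has a probability
below `ε` of changing colour at any stage. -/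
def StaticAlmostEverywhere (d : Dynamics) (ρ τg τr : ℝ) : Prop :=
  ∀ ε : ℝ, 0 < ε → ∃ W : ℕ, ∀ w : ℕ, W ≤ w → ∃ N : ℕ, ∀ (n : ℕ) [NeZero n], N ≤ n →
    nodeAndProcessLaw n w ρ τg τr d (changesColour n) < ENNReal.ofReal ε

/-! ### The thresholds -/

/-- The function whose level sets define the thresholds, on `0 < s < 1 / 2`. -/
def f (s : ℝ) : ℝ := (1 / 2 - s) ^ (1 - 2 * s) / (1 - s) ^ (2 * (1 - s))

open Classical in
/-- The root of `f s = y` in `(0, 1 / 2)` if there is one, and `1 / 2` otherwise. -/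
def root (y : ℝ) : ℝ :=
  if h : ∃ s : ℝ, s ∈ Set.Ioo 0 (1 / 2) ∧ f s = y then h.choose else 1 / 2

/-- The threshold for green. -/
def kappaG (ρ : ℝ) : ℝ := root (1 / (2 * (1 - ρ)))

/-- The threshold for red. -/
def kappaR (ρ : ℝ) : ℝ := root (1 / (2 * ρ))

/-! The root is unique where it exists, and it exists exactly for `1 / 2 < y < 2`. -/

theorem f_eq_exp {s : ℝ} (hs : s < 1 / 2) :
    f s = Real.exp ((1 - 2 * s) * Real.log (1 / 2 - s) - 2 * (1 - s) * Real.log (1 - s)) := by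
  rw [f, Real.rpow_def_of_pos (by linarith), Real.rpow_def_of_pos (by linarith), ← Real.exp_sub]
  congr 1
  ring

theorem continuousOn_f : ContinuousOn f (Set.Icc 0 (1 / 2)) := by
  have h : ∀ s ∈ Set.Icc (0 : ℝ) (1 / 2), f s =
      Real.exp (2 * ((1 / 2 - s) * Real.log (1 / 2 - s)) - 2 * ((1 - s) * Real.log (1 - s))) := by
    intro s hs
    rcases hs.2.lt_or_eq with h | rfl
    · rw [f_eq_exp h]
      congr 1
      ring
    · rw [f, Real.rpow_def_of_pos (by norm_num : (0 : ℝ) < 1 - 1 / 2)]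
      norm_num [← Real.exp_neg]
      ring
  refine ContinuousOn.congr (Continuous.continuousOn ?_) h
  have h1 : Continuous fun s : ℝ => (1 / 2 - s) * Real.log (1 / 2 - s) :=
    Real.continuous_mul_log.comp (continuous_const.sub continuous_id)
  have h2 : Continuous fun s : ℝ => (1 - s) * Real.log (1 - s) :=
    Real.continuous_mul_log.comp (continuous_const.sub continuous_id)
  fun_prop

theorem strictMonoOn_f : StrictMonoOn f (Set.Icc 0 (1 / 2)) := by
  refine strictMonoOn_of_deriv_pos (convex_Icc _ _) continuousOn_f ?_
  intro s hs
  rw [interior_Icc] at hs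
  have h1 : (0 : ℝ) < 1 / 2 - s := by linarith [hs.2]
  have h2 : (0 : ℝ) < 1 - s := by linarith
  have e : f =ᶠ[nhds s] fun s => Real.exp
      ((1 - 2 * s) * Real.log (1 / 2 - s) - 2 * (1 - s) * Real.log (1 - s)) := by
    filter_upwards [Iio_mem_nhds hs.2] with t ht using f_eq_exp ht
  have d1 : HasDerivAt (fun s : ℝ => 1 / 2 - s) (-1) s := by
    exact (hasDerivAt_id' s).const_sub (1 / 2)
  have d2 : HasDerivAt (fun s : ℝ => 1 - s) (-1) s := by
    simpa using (hasDerivAt_id s).const_sub 1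
  have d3 : HasDerivAt (fun s : ℝ => 1 - 2 * s) (-2) s := by
    simpa using ((hasDerivAt_id s).const_mul 2).const_sub 1
  have d4 : HasDerivAt (fun s : ℝ => 2 * (1 - s)) (-2) s := by
    simpa using d2.const_mul 2
  have D := ((d3.mul (d1.log h1.ne')).sub (d4.mul (d2.log h2.ne'))).exp
  rw [e.deriv_eq]
  have D' := D.deriv
  simp only [Pi.mul_def, Pi.sub_def] at D'
  rw [D']
  refine mul_pos (Real.exp_pos _) ?_
  have hl : Real.log (1 / 2 - s) < Real.log (1 - s) := Real.log_lt_log h1 (by linarith)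
  have a1 : (1 - 2 * s) * (-1 / (1 / 2 - s)) = -2 := by
    rw [mul_div_assoc', div_eq_iff h1.ne']
    ring
  have a2 : 2 * (1 - s) * (-1 / (1 - s)) = -2 := by
    rw [mul_div_assoc', div_eq_iff h2.ne']
    ring
  linarith

theorem existsUnique_root {y : ℝ} (h1 : 1 / 2 < y) (h2 : y < 2) :
    ∃! s : ℝ, s ∈ Set.Ioo 0 (1 / 2) ∧ f s = y := by
  have f0 : f 0 = 1 / 2 := by norm_num [f]
  have f1 : f (1 / 2) = 2 := by norm_num [f]
  obtain ⟨s, hs, hy⟩ := intermediate_value_Ioo (by norm_num) continuousOn_f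
    (show y ∈ Set.Ioo (f 0) (f (1 / 2)) by rw [f0, f1]; exact ⟨h1, h2⟩)
  refine ⟨s, ⟨hs, hy⟩, ?_⟩
  rintro t ⟨ht, hty⟩
  exact strictMonoOn_f.injOn (Set.Ioo_subset_Icc_self ht) (Set.Ioo_subset_Icc_self hs)
    (hty.trans hy.symm)

/-- For `ρ < 3 / 4` the threshold for green is the unique root of `f s = 1 / (2 * (1 - ρ))`. -/
theorem kappaG_eq_iff {ρ s : ℝ} (h0 : 0 < ρ) (h1 : ρ < 3 / 4) :
    kappaG ρ = s ↔ s ∈ Set.Ioo 0 (1 / 2) ∧ f s = 1 / (2 * (1 - ρ)) := by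
  have h := existsUnique_root (y := 1 / (2 * (1 - ρ)))
    (by rw [div_lt_div_iff₀] <;> linarith) (by rw [div_lt_iff₀] <;> linarith)
  have hr : kappaG ρ ∈ Set.Ioo 0 (1 / 2) ∧ f (kappaG ρ) = 1 / (2 * (1 - ρ)) := by
    rw [kappaG, root, dif_pos h.exists]
    exact h.exists.choose_spec
  exact ⟨fun e => e ▸ hr, fun e => h.unique hr e⟩

/-- For `ρ ≥ 3 / 4` the threshold for green is `1 / 2`. -/
theorem kappaG_of_le {ρ : ℝ} (h0 : 3 / 4 ≤ ρ) (h1 : ρ < 1) : kappaG ρ = 1 / 2 := by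
  rw [kappaG, root, dif_neg]
  rintro ⟨s, hs, hy⟩
  have f1 : f (1 / 2) = 2 := by norm_num [f]
  have := strictMonoOn_f (Set.Ioo_subset_Icc_self hs) (Set.right_mem_Icc.2 (by norm_num)) hs.2
  rw [hy, f1, div_lt_iff₀ (by linarith)] at this
  linarith

/-- The threshold for red is obtained from the one for green by exchanging `ρ` and `1 - ρ`. -/
theorem kappaR_eq (ρ : ℝ) : kappaR ρ = kappaG (1 - ρ) := by
  rw [kappaR, kappaG, sub_sub_cancel]

end Schelling

end

/-! All three dynamics recolour only unhappy nodes, and nothing else about them is used. Let `u`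
have initial colour `γ`. Suppose that on each side of `u` some block of `w + 1` consecutive nodes is
stable, that is, has at least `τ * (2 * w + 1)` nodes of colour `γ`, and that all `γ` nodes from one
block to the other are initially happy. Then none of these nodes ever changes (`colour_persists`): a
node in an end block sees that whole block, and any other sees only nodes of the protected stretch,
so there can be no first loss of `γ`. Nodes that turn to `γ` only help.

It remains to find such blocks. Let `p` be the probability of `γ`, `t` its tolerance and `D` the
relative entropy to `p`. A node of colour `γ` is unhappy with probability at most `exp (-(2w+1)
D(t))` (`measureReal_unhappy_le`). A block is stable with probability at least about `exp (-w
D(2s))` for any `s ≥ t`, since `s * (2w+1)` nodes out of `w + 1` have density about `2s`. The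
identity `2 D(t) - D(2t) = -log (f t * 2(1-p))` (`two_mul_relEntropy_sub`) shows that below the
threshold stable blocks are exponentially more frequent than unhappy nodes. Hence there is a scale
(`exists_number_of_blocks`) at which both sides of `u` contain a stable block but, very likely, no
unhappy node of colour `γ` is met. -/

open MeasureTheory ProbabilityTheory

noncomputable section

namespace Schelling

/-! ### Deterministic part -/

/-- The arc of the ring consisting of the nodes `u + i` for `a ≤ i ≤ b`. -/
def arc {n : ℕ} (u : ZMod n) (a b : ℤ) : Finset (ZMod n) :=
  (Finset.Icc a b).image fun i : ℤ => u + (i : ZMod n)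

/-- The number of nodes of colour `γ` in `S`. -/
def count {α : Type*} (γ : Colour) (S : Finset α) (c : α → Colour) : ℕ :=
  (S.filter fun y => c y = γ).card

theorem count_mono {α : Type*} {γ : Colour} {S T : Finset α} {c c' : α → Colour} (hST : S ⊆ T)
    (h : ∀ y ∈ S, c y = γ → c' y = γ) : count γ S c ≤ count γ T c' :=
  Finset.card_le_card fun y hy => by
    rw [Finset.mem_filter] at hy ⊢
    exact ⟨hST hy.1, h y hy.1 hy.2⟩

theorem mem_arc {n : ℕ} {u : ZMod n} {a b i : ℤ} (h1 : a ≤ i) (h2 : i ≤ b) :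
    u + (i : ZMod n) ∈ arc u a b :=
  Finset.mem_image.2 ⟨i, Finset.mem_Icc.2 ⟨h1, h2⟩, rfl⟩

theorem arc_subset_arc {n : ℕ} {u : ZMod n} {a b a' b' : ℤ} (ha : a' ≤ a) (hb : b ≤ b') :
    arc u a b ⊆ arc u a' b' :=
  Finset.image_subset_image (Finset.Icc_subset_Icc ha hb)

theorem neighbourhood_add {n : ℕ} (w : ℕ) (u : ZMod n) (i : ℤ) :
    neighbourhood w (u + (i : ZMod n)) = arc u (i - w) (i + w) := by
  ext y
  simp only [neighbourhood, arc, Finset.mem_image, Finset.mem_Icc]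
  constructor
  · rintro ⟨j, hj, rfl⟩
    exact ⟨i + j, by omega, by push_cast; ring⟩
  · rintro ⟨j, hj, rfl⟩
    exact ⟨j - i, by omega, by push_cast; ring⟩

theorem card_arc {n : ℕ} {u : ZMod n} {a b : ℤ} (h : b - a < n) :
    (arc u a b).card = (b + 1 - a).toNat := by
  rw [arc, Finset.card_image_of_injOn, Int.card_Icc]
  intro i hi j hj hij
  have hij' : (i : ZMod n) = (j : ZMod n) := add_left_cancel hij
  rw [Finset.coe_Icc, Set.mem_Icc] at hi hj
  rw [ZMod.intCast_eq_intCast_iff_dvd_sub] at hij'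
  have := Int.eq_zero_of_abs_lt_dvd hij' (by rw [abs_lt]; omega)
  omega

theorem disjoint_arc {n : ℕ} {u : ZMod n} {a b a' b' : ℤ} (h : b < a') (h' : b' - a < n) :
    Disjoint (arc u a b) (arc u a' b') := by
  rw [Finset.disjoint_left]
  intro y hy hy'
  simp only [arc, Finset.mem_image, Finset.mem_Icc] at hy hy'
  obtain ⟨i, hi, rfl⟩ := hy
  obtain ⟨j, hj, hij⟩ := hy'
  have hij' : (j : ZMod n) = (i : ZMod n) := add_left_cancel hij
  rw [ZMod.intCast_eq_intCast_iff_dvd_sub] at hij'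
  have := Int.eq_zero_of_abs_lt_dvd hij' (by rw [abs_lt]; omega)
  omega

/-- A set of nodes is stable for `γ` if it contains enough nodes of that colour to keep happy
every node of colour `γ` whose neighbourhood contains the set. -/
def Stable {n : ℕ} (w : ℕ) (τg τr : ℝ) (γ : Colour) (S : Finset (ZMod n)) (c : Colouring n) :
    Prop :=
  tolerance τg τr γ * (2 * (w : ℝ) + 1) ≤ (count γ S c : ℝ)

theorem Stable.mono {n w : ℕ} {τg τr : ℝ} {γ : Colour} {S T : Finset (ZMod n)}
    {c c' : Colouring n} (hS : Stable w τg τr γ S c) (hST : S ⊆ T)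
    (h : ∀ y ∈ S, c y = γ → c' y = γ) : Stable w τg τr γ T c' :=
  hS.trans (Nat.cast_le.2 (count_mono hST h))

theorem happy_iff_stable {n w : ℕ} {τg τr : ℝ} {γ : Colour} {c : Colouring n} {x : ZMod n}
    (hx : c x = γ) : Happy w τg τr c x ↔ Stable w τg τr γ (neighbourhood w x) c := by
  subst hx
  rfl

/-- If only unhappy nodes change colour, then between two stable arcs no node ever loses the
colour `γ`, provided that all nodes of that colour were happy there initially. -/
theorem colour_persists {n w : ℕ} {τg τr : ℝ} {c : ℕ → Colouring n}
    (hc : ∀ t y, c (t + 1) y ≠ c t y → ¬ Happy w τg τr (c t) y) {γ : Colour} {u : ZMod n}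
    {a b : ℤ} (hab : a + w ≤ b) (ha : Stable w τg τr γ (arc u a (a + w)) (c 0))
    (hb : Stable w τg τr γ (arc u (b - w) b) (c 0))
    (hmid : ∀ i : ℤ, a ≤ i → i ≤ b → c 0 (u + i) = γ → Happy w τg τr (c 0) (u + i)) (t : ℕ) :
    ∀ y ∈ arc u a b, c 0 y = γ → c t y = γ := by
  induction t with
  | zero => exact fun _ _ h => h
  | succ t ih =>
    intro y hy h0
    obtain ⟨i, hi, rfl⟩ := Finset.mem_image.1 hy
    rw [Finset.mem_Icc] at hi
    have ht := ih _ hy h0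
    by_contra hne
    refine hc t _ (fun h => hne (h.trans ht)) ((happy_iff_stable ht).2 ?_)
    rw [neighbourhood_add]
    -- Within an end block the neighbourhood contains that block of diameter `w`. Strictly between
    -- the end blocks it lies inside the protected arc, where by induction the initial `γ` nodes are
    -- all still `γ`.
    rcases le_or_gt i (a + w) with h1 | h1
    · exact ha.mono (arc_subset_arc (by omega) (by omega))
        fun z hz => ih z (arc_subset_arc le_rfl (by omega) hz)
    rcases le_or_gt (b - w) i with h2 | h2
    · exact hb.mono (arc_subset_arc (by omega) (by omega))
        fun z hz => ih z (arc_subset_arc (by omega) le_rfl hz)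
    · have := (happy_iff_stable h0).1 (hmid i hi.1 hi.2 h0)
      rw [neighbourhood_add] at this
      exact this.mono subset_rfl fun z hz => ih z (arc_subset_arc (by omega) (by omega) hz)

/-- The `k`-th block of `w + 1` nodes to the right of `u`. -/
def rightBlock {n : ℕ} (w : ℕ) (u : ZMod n) (k : ℕ) : Finset (ZMod n) :=
  arc u (1 + k * (w + 1)) (1 + k * (w + 1) + w)

/-- The `k`-th block of `w + 1` nodes to the left of `u`. -/
def leftBlock {n : ℕ} (w : ℕ) (u : ZMod n) (k : ℕ) : Finset (ZMod n) :=
  arc u (-(1 + k * (w + 1)) - w) (-(1 + k * (w + 1)))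

/-- The protected arc runs from the outer end of the left block to that of the right block. Its
happiness is assumed on the larger, deterministic arc of all `M` blocks, which suits a union bound.
-/
theorem colour_eq_of_blocks {n w : ℕ} {τg τr : ℝ} {c : ℕ → Colouring n}
    (hc : ∀ t y, c (t + 1) y ≠ c t y → ¬ Happy w τg τr (c t) y) {u : ZMod n} {M : ℕ}
    (hr : ∃ k < M, Stable w τg τr (c 0 u) (rightBlock w u k) (c 0))
    (hl : ∃ k < M, Stable w τg τr (c 0 u) (leftBlock w u k) (c 0))
    (hmid : ∀ y ∈ arc u (-(M * (w + 1) : ℤ)) (M * (w + 1)),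
      c 0 y = c 0 u → Happy w τg τr (c 0) y) (t : ℕ) :
    c t u = c 0 u := by
  obtain ⟨k, hk, hks⟩ := hr
  obtain ⟨l, hl, hls⟩ := hl
  have hk' : ((k : ℤ) + 1) * (w + 1) ≤ M * (w + 1) := by
    have : (k : ℤ) + 1 ≤ M := by exact_mod_cast hk
    gcongr
  have hl' : ((l : ℤ) + 1) * (w + 1) ≤ M * (w + 1) := by
    have : (l : ℤ) + 1 ≤ M := by exact_mod_cast hl
    gcongr
  have hk0 : 0 ≤ (k : ℤ) * (w + 1) := by positivity
  have hl0 : 0 ≤ (l : ℤ) * (w + 1) := by positivity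
  have := colour_persists (γ := c 0 u) (u := u) (a := -(1 + l * (w + 1)) - w)
    (b := 1 + k * (w + 1) + w) hc (by linarith)
    (by rwa [sub_add_cancel]) (by rwa [add_sub_cancel_right])
    (fun i h1 h2 => hmid _ (mem_arc (by linarith) (by linarith))) t u
  refine this ?_ rfl
  simpa using mem_arc (u := u) (i := 0) (a := -(1 + l * (w + 1)) - w)
    (b := 1 + k * (w + 1) + w) (by linarith) (by linarith)

/-! ### The process -/

theorem recolourRandom_support {n : ℕ} {c c' : Colouring n} {s : Finset (ZMod n)}
    (h : c' ∈ (recolourRandom c s).support) {y : ZMod n} (hy : c' y ≠ c y) : y ∈ s := by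
  rw [recolourRandom] at h
  split_ifs at h with hs
  · obtain ⟨x, hx, rfl⟩ := (PMF.mem_support_map_iff _ _ _).1 h
    rw [PMF.mem_support_uniformOfFinset_iff] at hx
    rcases eq_or_ne y x with rfl | hyx
    · exact hx
    · exact absurd (by simp [recolour, hyx]) hy
  · rw [PMF.mem_support_pure_iff] at h
    exact absurd (by rw [h]) hy

/-- The only property of the dynamics that the argument needs; hopeful nodes are unhappy by
definition. -/
theorem not_happy_of_nextColouring {n : ℕ} [NeZero n] {w : ℕ} {τg τr : ℝ} {d : Dynamics}
    {c c' : Colouring n} (h : c' ∈ (nextColouring w τg τr d c).support) {y : ZMod n}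
    (hy : c' y ≠ c y) : ¬ Happy w τg τr c y := by
  classical
  cases d with
  | selective =>
    have := recolourRandom_support h hy
    exact (Finset.mem_filter.1 this).2.1
  | incremental =>
    have := recolourRandom_support h hy
    exact (Finset.mem_filter.1 this).2
  | synchronous =>
    rw [nextColouring, PMF.mem_support_pure_iff] at h
    intro hh
    refine hy ?_
    rw [h]
    exact if_pos hh

instance (n : ℕ) [NeZero n] : DiscreteMeasurableSpace (Colouring n) where
  forall_measurableSet s := (Set.to_countable s).measurableSet

theorem ae_stepKernel {n : ℕ} [NeZero n] (w : ℕ) (τg τr : ℝ) (d : Dynamics) (c : Colouring n) :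
    ∀ᵐ c' ∂stepKernel w τg τr d c, ∀ y, c' y ≠ c y → ¬ Happy w τg τr c y := by
  change (nextColouring w τg τr d c).toMeasure _ = 0
  rw [PMF.toMeasure_apply_eq_zero_iff _ (MeasurableSet.of_discrete), Set.disjoint_left]
  exact fun c' h h' => h' fun y hy => not_happy_of_nextColouring h hy

theorem isProbabilityMeasure_coin {ρ : ℝ} (h0 : 0 ≤ ρ) (h1 : ρ ≤ 1) :
    IsProbabilityMeasure (coin ρ) := by
  constructor
  simp only [coin, Measure.add_apply, Measure.smul_apply, measure_univ, smul_eq_mul, mul_one]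
  rw [← ENNReal.ofReal_add h0 (by linarith)]
  simp

/-- The joint law of the history up to `t` and the next colouring is a composition-product with the
transition kernel, so the one-step property transfers to almost every trajectory. -/
theorem ae_processLaw {n : ℕ} [NeZero n] (w : ℕ) (ρ τg τr : ℝ) (d : Dynamics)
    [IsProbabilityMeasure (initialLaw n ρ)] :
    ∀ᵐ c ∂processLaw n w ρ τg τr d,
      ∀ t y, c (t + 1) y ≠ c t y → ¬ Happy w τg τr (c t) y := by
  rw [ae_all_iff]
  intro t
  have hm : MeasurableSet {p : Colouring n × Colouring n |
      ∀ y, p.2 y ≠ p.1 y → ¬ Happy w τg τr p.1 y} := (Set.to_countable _).measurableSet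
  have key := Kernel.map_frestrictLe_trajMeasure_compProd_eq_map_trajMeasure
    (X := fun _ => Colouring n) (μ₀ := initialLaw n ρ) (κ := historyKernel w τg τr d) (a := t)
  have hlast : Measurable fun p : ((_ : Finset.Iic t) → Colouring n) × Colouring n =>
      (p.1 ⟨t, Finset.mem_Iic.2 le_rfl⟩, p.2) := by fun_prop
  have h2 : ∀ᵐ p ∂((processLaw n w ρ τg τr d).map (Preorder.frestrictLe t)) ⊗ₘ
      (historyKernel w τg τr d t),
      ∀ y, p.2 y ≠ p.1 ⟨t, Finset.mem_Iic.2 le_rfl⟩ y →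
        ¬ Happy w τg τr (p.1 ⟨t, Finset.mem_Iic.2 le_rfl⟩) y := by
    refine (Measure.ae_compProd_iff (hlast hm)).2 (Filter.Eventually.of_forall fun h => ?_)
    exact ae_stepKernel w τg τr d _
  rw [processLaw, key] at h2
  exact ae_of_ae_map (by fun_prop) h2

theorem map_processLaw_zero {n : ℕ} [NeZero n] (w : ℕ) (ρ τg τr : ℝ) (d : Dynamics)
    [IsProbabilityMeasure (initialLaw n ρ)] :
    (processLaw n w ρ τg τr d).map (fun c => c 0) = initialLaw n ρ := by
  have h1 : (fun c : ℕ → Colouring n => c 0) =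
      (fun h : (_ : Finset.Iic 0) → Colouring n => h ⟨0, Finset.mem_Iic.2 le_rfl⟩) ∘
        Preorder.frestrictLe 0 := rfl
  rw [h1, ← Measure.map_map (by fun_prop) (by fun_prop), processLaw, Kernel.trajMeasure,
    Measure.map_comp _ _ (by fun_prop), Kernel.traj_map_frestrictLe, Kernel.partialTraj_self,
    Measure.id_comp, Measure.map_map (by fun_prop) (by fun_prop)]
  exact Measure.map_id

/-- If from every node the probability of a bad initial colouring is at most `δ`, and from a good
initial colouring the node never changes, then a random node changes with probability at most
`δ`. -/
theorem nodeAndProcessLaw_changesColour_le {n : ℕ} [NeZero n] {w : ℕ} {ρ τg τr : ℝ} {d : Dynamics}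
    [IsProbabilityMeasure (initialLaw n ρ)] {δ : ENNReal} (B : ZMod n → Set (Colouring n))
    (hB : ∀ u, initialLaw n ρ (B u) ≤ δ)
    (h : ∀ u (c : ℕ → Colouring n),
      (∀ t y, c (t + 1) y ≠ c t y → ¬ Happy w τg τr (c t) y) → c 0 ∉ B u → ∀ t, c t u = c 0 u) :
    nodeAndProcessLaw n w ρ τg τr d (changesColour n) ≤ δ := by
  have : IsProbabilityMeasure (processLaw n w ρ τg τr d) := by
    rw [processLaw]; infer_instance
  have hms : MeasurableSet (changesColour n) := by
    have : changesColour n = ⋃ (t : ℕ), ⋃ (u : ZMod n),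
        ({u} ×ˢ {c : ℕ → Colouring n | c (t + 1) u ≠ c t u}) := by
      ext p; simp [changesColour]
    rw [this]
    refine MeasurableSet.iUnion fun t => MeasurableSet.iUnion fun u => ?_
    refine (measurableSet_singleton u).prod (MeasurableSet.compl ?_)
    exact measurableSet_eq_fun (by fun_prop) (by fun_prop)
  rw [nodeAndProcessLaw, Measure.prod_apply hms]
  calc _ ≤ ∫⁻ _, δ ∂(PMF.uniformOfFintype (ZMod n)).toMeasure := by
        refine lintegral_mono fun u => ?_
        calc _ ≤ processLaw n w ρ τg τr d ((fun c => c 0) ⁻¹' B u) := by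
              refine measure_mono_ae ?_
              filter_upwards [ae_processLaw w ρ τg τr d] with c hc
              rintro ⟨t, ht⟩
              by_contra hb
              exact ht ((h u c hc hb _).trans (h u c hc hb _).symm)
          _ = initialLaw n ρ (B u) := by
              rw [← Measure.map_apply (by fun_prop) MeasurableSet.of_discrete,
                map_processLaw_zero]
          _ ≤ δ := hB u
    _ = δ := by simp

/-! ### Independent coins -/

theorem count_congr {ι : Type*} {γ : Colour} {S : Finset ι} {c c' : ι → Colour} (h : ∀ i ∈ S, c i = c' i) :
    count γ S c = count γ S c' := by
  unfold count
  congr 1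
  exact Finset.filter_congr fun i hi => by rw [h i hi]

section Coins

variable {ι : Type*} [Fintype ι]

theorem measureReal_not (ν : Measure Colour) [IsProbabilityMeasure ν] (γ : Colour) :
    ν.real {!γ} = 1 - ν.real {γ} := by
  rw [← probReal_compl_eq_one_sub (measurableSet_singleton γ)]
  congr 1
  ext b
  cases b <;> cases γ <;> simp

/-- The binomial tail is bounded below by its single term "exactly `m`", a disjoint union of
cylinders `A T` over the `m`-subsets `T` of `S`. -/
theorem choose_mul_le_measureReal_count (ν : Measure Colour) [IsProbabilityMeasure ν] (γ : Colour)
    (S : Finset ι) (m : ℕ) :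
    (S.card.choose m : ℝ) * (ν.real {γ} ^ m * (1 - ν.real {γ}) ^ (S.card - m)) ≤
      (Measure.pi fun _ : ι => ν).real {c | m ≤ count γ S c} := by
  classical
  let A : Finset ι → Set (ι → Colour) := fun T =>
    Set.univ.pi fun i => if i ∈ T then {γ} else if i ∈ S then {!γ} else Set.univ
  have hA : ∀ T ⊆ S, ∀ c ∈ A T, S.filter (fun i => c i = γ) = T := by
    intro T hT c hc
    ext i
    have hi := hc i (Set.mem_univ i)
    by_cases h1 : i ∈ T
    · simp only [h1, if_true, Set.mem_singleton_iff] at hi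
      simp [hi, h1, hT h1]
    · by_cases h2 : i ∈ S
      · simp only [h1, h2, if_true, if_false, Set.mem_singleton_iff] at hi
        simp [hi, h1]
      · simp [h1, h2]
  have hμ : ∀ T ∈ S.powersetCard m, (Measure.pi fun _ : ι => ν).real (A T) =
      ν.real {γ} ^ m * (1 - ν.real {γ}) ^ (S.card - m) := by
    intro T hT
    obtain ⟨hTS, rfl⟩ := Finset.mem_powersetCard.1 hT
    rw [measureReal_def, Measure.pi_pi, ENNReal.toReal_prod, ← measureReal_not,
      ← Finset.card_sdiff_of_subset hTS, ← Finset.prod_const, ← Finset.prod_const,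
      ← Finset.prod_subset (Finset.subset_univ S), ← Finset.prod_sdiff hTS, mul_comm]
    · congr 1
      · exact Finset.prod_congr rfl fun i hi => by rw [if_pos hi, measureReal_def]
      · refine Finset.prod_congr rfl fun i hi => ?_
        rw [Finset.mem_sdiff] at hi
        rw [if_neg hi.2, if_pos hi.1, measureReal_def]
    · intro i _ hi
      simp only [hi, mt (@hTS i) hi, if_false, measure_univ, ENNReal.toReal_one]
  calc _ = (Measure.pi fun _ : ι => ν).real (⋃ T ∈ S.powersetCard m, A T) := by
        rw [measureReal_biUnion_finset, Finset.sum_congr rfl hμ, Finset.sum_const,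
          Finset.card_powersetCard, nsmul_eq_mul]
        · intro T hT T' hT' hne
          rw [Finset.mem_coe, Finset.mem_powersetCard] at hT hT'
          refine Set.disjoint_left.2 fun c hc hc' => hne ?_
          rw [← hA T hT.1 c hc, ← hA T' hT'.1 c hc']
        · intro T _
          exact (Set.to_countable _).measurableSet
    _ ≤ _ := by
        refine measureReal_mono ?_
        refine Set.iUnion₂_subset fun T hT c hc => ?_
        rw [Finset.mem_powersetCard] at hT
        simp only [Set.mem_ofPred_eq, count]
        rw [hA T hT.1 c hc, hT.2]

theorem integral_coin (ν : Measure Colour) [IsProbabilityMeasure ν] (γ : Colour) (a b : ℝ) :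
    ∫ x, (if x = γ then a else b) ∂ν = ν.real {γ} * a + (1 - ν.real {γ}) * b := by
  rw [integral_fintype (Integrable.of_finite), Fintype.sum_bool, ← measureReal_not]
  cases γ <;> simp [add_comm]

/-- The exponential Markov inequality for the number of coins of colour `γ`. -/
theorem measureReal_count_lt_le (ν : Measure Colour) [IsProbabilityMeasure ν] (γ : Colour)
    (S : Finset ι) (x : ℝ) {l : ℝ} (hl : 0 < l) (hl1 : l ≤ 1) :
    (Measure.pi fun _ : ι => ν).real {c | (count γ S c : ℝ) < x} ≤
      l ^ (-x) * (ν.real {γ} * l + (1 - ν.real {γ})) ^ S.card := by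
  classical
  -- With factors 1 outside `S`, the power of `l` becomes a product over all coins, whose
  -- expectation factorises.
  have hprod : ∀ c : ι → Colour, ∏ i, (if i ∈ S then (if c i = γ then l else 1) else 1) =
      l ^ count γ S c := by
    intro c
    rw [Finset.prod_ite_mem, Finset.univ_inter, Finset.prod_ite, Finset.prod_const,
      Finset.prod_const_one, mul_one, count]
  have hint : ∫ c : ι → Colour, l ^ count γ S c ∂(Measure.pi fun _ => ν) =
      (ν.real {γ} * l + (1 - ν.real {γ})) ^ S.card := by
    simp_rw [← hprod]
    rw [integral_fintype_prod_eq_prod (𝕜 := ℝ)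
      (fun i b => if i ∈ S then (if b = γ then l else 1) else 1), ← Finset.prod_const,
      ← Finset.prod_subset (Finset.subset_univ S)]
    · refine Finset.prod_congr rfl fun i hi => ?_
      simp only [hi, if_true]
      rw [integral_coin, mul_one]
    · intro i _ hi
      simp only [hi, if_false, integral_const, probReal_univ, smul_eq_mul, mul_one]
  have hmarkov := mul_meas_ge_le_integral_of_nonneg (μ := Measure.pi fun _ : ι => ν)
    (f := fun c => l ^ count γ S c) (Filter.Eventually.of_forall fun c => by positivity)
    Integrable.of_finite (l ^ x)
  rw [hint] at hmarkov
  rw [Real.rpow_neg hl.le, inv_mul_eq_div, le_div_iff₀ (Real.rpow_pos_of_pos hl x), mul_comm]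
  refine le_trans (mul_le_mul_of_nonneg_left (measureReal_mono ?_) (Real.rpow_nonneg hl.le x))
    hmarkov
  intro c hc
  have hc' : (count γ S c : ℝ) < x := hc
  change l ^ x ≤ l ^ count γ S c
  rw [← Real.rpow_natCast]
  exact Real.rpow_le_rpow_of_exponent_ge hl hl1 hc'.le

/-- Events that depend on disjoint sets of coins are independent. -/
theorem measureReal_inter_of_disjoint (ν : Measure Colour) [IsProbabilityMeasure ν]
    {U V : Finset ι} (hUV : Disjoint U V) {E F : Set (ι → Colour)}
    (hE : ∀ c c' : ι → Colour, (∀ i ∈ U, c i = c' i) → c ∈ E → c' ∈ E)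
    (hF : ∀ c c' : ι → Colour, (∀ i ∈ V, c i = c' i) → c ∈ F → c' ∈ F) :
    (Measure.pi fun _ : ι => ν).real (E ∩ F) =
      (Measure.pi fun _ : ι => ν).real E * (Measure.pi fun _ : ι => ν).real F := by
  have hind : iIndepFun (fun (i : ι) (c : ι → Colour) => c i) (Measure.pi fun _ : ι => ν) :=
    iIndepFun_pi (X := fun _ b => b) fun _ => aemeasurable_id
  have h := hind.indepFun_finset U V hUV fun i => measurable_pi_apply i
  -- An event determined by the coins in `W` is the preimage of its own image under restriction to
  -- `W`.
  have pre : ∀ (W : Finset ι) (G : Set (ι → Colour)),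
      (∀ c c' : ι → Colour, (∀ i ∈ W, c i = c' i) → c ∈ G → c' ∈ G) →
      (fun (c : ι → Colour) (i : W) => c i) ⁻¹' ((fun (c : ι → Colour) (i : W) => c i) '' G) = G := by
    intro W G hG
    refine Set.Subset.antisymm ?_ (Set.subset_preimage_image _ _)
    rintro c ⟨c', hc', he⟩
    exact hG c' c (fun i hi => congrFun he ⟨i, hi⟩) hc'
  have := h.measure_inter_preimage_eq_mul
    ((fun (c : ι → Colour) (i : U) => c i) '' E) ((fun (c : ι → Colour) (i : V) => c i) '' F)
    (Set.to_countable _).measurableSet (Set.to_countable _).measurableSet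
  rw [pre U E hE, pre V F hF] at this
  simp only [measureReal_def, this, ENNReal.toReal_mul]

/-- Disjoint sets give independent trials, each failing with probability at most `1 - q`. -/
theorem measureReal_forall_count_lt_le (ν : Measure Colour) [IsProbabilityMeasure ν] (γ : Colour)
    (S : ℕ → Finset ι) (m : ℕ) {q : ℝ} (hq1 : q ≤ 1) (M : ℕ)
    (hS : ∀ k < M, ∀ l < k, Disjoint (S l) (S k))
    (hq : ∀ k < M, q ≤ (Measure.pi fun _ : ι => ν).real {c | m ≤ count γ (S k) c}) :
    (Measure.pi fun _ : ι => ν).real {c | ∀ k < M, ¬ m ≤ count γ (S k) c} ≤ (1 - q) ^ M := by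
  classical
  induction M with
  | zero => simp
  | succ M ih =>
    have hset : {c : ι → Colour | ∀ k < M + 1, ¬ m ≤ count γ (S k) c} =
        {c | ∀ k < M, ¬ m ≤ count γ (S k) c} ∩ {c | m ≤ count γ (S M) c}ᶜ := by
      ext c
      simp only [Nat.lt_succ_iff_lt_or_eq, Set.mem_ofPred_eq, Set.mem_inter_iff, Set.mem_compl_iff]
      constructor
      · exact fun h => ⟨fun k hk => h k (Or.inl hk), h M (Or.inr rfl)⟩
      · rintro ⟨h1, h2⟩ k (hk | rfl)
        exacts [h1 k hk, h2]
    rw [hset, measureReal_inter_of_disjoint ν (U := (Finset.range M).biUnion S) (V := S M),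
      probReal_compl_eq_one_sub (Set.to_countable _).measurableSet, pow_succ]
    · refine mul_le_mul (ih (fun k hk => hS k (by omega)) fun k hk => hq k (by omega)) ?_ ?_ ?_
      · linarith [hq M (by omega)]
      · linarith [measureReal_le_one (μ := Measure.pi fun _ : ι => ν)
          (s := {c | m ≤ count γ (S M) c})]
      · exact pow_nonneg (by linarith) _
    · exact (Finset.disjoint_biUnion_left _ _ _).2 fun l hl =>
        hS M (by omega) l (Finset.mem_range.1 hl)
    · intro c c' h hc k hk
      rw [← count_congr fun i hi => h i (Finset.mem_biUnion.2 ⟨k, Finset.mem_range.2 hk, hi⟩)]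
      exact hc k hk
    · intro c c' h hc
      rw [Set.mem_compl_iff, Set.mem_ofPred_eq, ← count_congr h]
      exact hc

end Coins

/-! ### Relative entropy and the thresholds -/

/-- The relative entropy of a coin with bias `x` with respect to a coin with bias `p`. -/
def relEntropy (p x : ℝ) : ℝ :=
  x * Real.log x + (1 - x) * Real.log (1 - x) - x * Real.log p - (1 - x) * Real.log (1 - p)

theorem continuous_relEntropy (p : ℝ) : Continuous (relEntropy p) := by
  unfold relEntropy
  have h1 : Continuous fun x : ℝ => x * Real.log x := Real.continuous_mul_log
  have h2 : Continuous fun x : ℝ => (1 - x) * Real.log (1 - x) :=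
    Real.continuous_mul_log.comp (continuous_const.sub continuous_id)
  fun_prop

theorem relEntropy_self (p : ℝ) : relEntropy p p = 0 := by
  unfold relEntropy
  ring

/-- Gibbs' inequality, from `log y ≤ y - 1` at `y = p / x` and `y = (1 - p) / (1 - x)`. -/
theorem relEntropy_nonneg {p x : ℝ} (hp : p ∈ Set.Ioo (0 : ℝ) 1) (hx : x ∈ Set.Ioo (0 : ℝ) 1) :
    0 ≤ relEntropy p x := by
  obtain ⟨hp0, hp1⟩ := hp
  obtain ⟨hx0, hx1⟩ := hx
  have hp1' : 0 < 1 - p := by linarith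
  have hx1' : 0 < 1 - x := by linarith
  have h1 := mul_le_mul_of_nonneg_left (Real.log_le_sub_one_of_pos (div_pos hp0 hx0)) hx0.le
  have h2 := mul_le_mul_of_nonneg_left (Real.log_le_sub_one_of_pos (div_pos hp1' hx1')) hx1'.le
  rw [Real.log_div hp0.ne' hx0.ne', mul_sub x (p / x), mul_div_cancel₀ _ hx0.ne'] at h1
  rw [Real.log_div hp1'.ne' hx1'.ne', mul_sub (1 - x) ((1 - p) / (1 - x)),
    mul_div_cancel₀ _ hx1'.ne'] at h2
  unfold relEntropy
  linarith

/-- The origin of `f`: the terms in `log p` and `log s` cancel, and the multiples of `log 2` add up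
to one. -/
theorem two_mul_relEntropy_sub {p s : ℝ} (hs : s ∈ Set.Ioo (0 : ℝ) (1 / 2)) (hp : p < 1) :
    2 * relEntropy p s - relEntropy p (2 * s) = -Real.log (f s * (2 * (1 - p))) := by
  have h1 : 0 < 1 / 2 - s := by linarith [hs.2]
  rw [Real.log_mul (by rw [f_eq_exp hs.2]; positivity) (by linarith),
    Real.log_mul two_ne_zero (by linarith), f_eq_exp hs.2, Real.log_exp, relEntropy, relEntropy,
    show 1 - 2 * s = 2 * (1 / 2 - s) by ring, Real.log_mul two_ne_zero h1.ne',
    Real.log_mul two_ne_zero hs.1.ne']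
  ring

theorem f_mul_lt_one {p t : ℝ} (hp : p ∈ Set.Ioo (0 : ℝ) 1) (ht : 0 < t) (h : t < kappaG p) :
    t < 1 / 2 ∧ f t * (2 * (1 - p)) < 1 := by
  have hp1 : 0 < 1 - p := by linarith [hp.2]
  rcases lt_or_ge p (3 / 4) with h3 | h3
  · obtain ⟨hk, hfk⟩ := (kappaG_eq_iff hp.1 h3).1 rfl
    have ht2 : t < 1 / 2 := h.trans hk.2
    refine ⟨ht2, ?_⟩
    have := strictMonoOn_f ⟨ht.le, ht2.le⟩ (Set.Ioo_subset_Icc_self hk) h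
    rwa [hfk, lt_div_iff₀ (by linarith)] at this
  · rw [kappaG_of_le h3 hp.2] at h
    refine ⟨h, ?_⟩
    have := strictMonoOn_f ⟨ht.le, h.le⟩ (Set.right_mem_Icc.2 (by norm_num)) h
    have f1 : f (1 / 2) = 2 := by norm_num [f]
    have f0 : 0 < f t := by rw [f_eq_exp h]; positivity
    rw [f1] at this
    nlinarith

theorem relEntropy_two_mul_lt {p s : ℝ} (hp : p ∈ Set.Ioo (0 : ℝ) 1)
    (hs : s ∈ Set.Ioo (0 : ℝ) (1 / 2)) (h : f s * (2 * (1 - p)) < 1) :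
    relEntropy p (2 * s) < 2 * relEntropy p s := by
  have f0 : 0 < f s := by rw [f_eq_exp hs.2]; positivity
  have := Real.log_neg (mul_pos f0 (by linarith [hp.2])) h
  linarith [two_mul_relEntropy_sub hs hp.2]

/-- Below the threshold, stable arcs are exponentially more frequent than unhappy nodes. -/
theorem exists_relEntropy_lt {p t : ℝ} (hp : p ∈ Set.Ioo (0 : ℝ) 1) (ht : 0 < t)
    (h : t < kappaG p) :
    t < p ∧ ∃ s ∈ Set.Ioo (0 : ℝ) (1 / 2), t ≤ s ∧ relEntropy p (2 * s) < 2 * relEntropy p t := by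
  obtain ⟨ht2, hf⟩ := f_mul_lt_one hp ht h
  have hlt := relEntropy_two_mul_lt hp ⟨ht, ht2⟩ hf
  have hpos : 0 < relEntropy p t := by
    have := relEntropy_nonneg hp (x := 2 * t) ⟨by linarith, by linarith⟩
    linarith
  -- If `p ≤ t`, monotonicity of `f` would give the strict inequality at `s = p` too, that is,
  -- `D(2p) < 2 D(p) = 0`.
  have htp : t < p := by
    by_contra! hpt
    have hp2 : p < 1 / 2 := by linarith
    have hfp : f p ≤ f t :=
      strictMonoOn_f.monotoneOn ⟨hp.1.le, hp2.le⟩ ⟨ht.le, ht2.le⟩ hpt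
    have h1 := relEntropy_two_mul_lt hp ⟨hp.1, hp2⟩
      ((mul_le_mul_of_nonneg_right hfp (by linarith [hp.2])).trans_lt hf)
    have h2 := relEntropy_nonneg hp (x := 2 * p) ⟨by linarith [hp.1], by linarith⟩
    rw [relEntropy_self] at h1
    linarith
  refine ⟨htp, ?_⟩
  -- If `2 * t < p`, blocks of density `p` are already stable and typical; `2 * s = p` makes their
  -- exponent zero.
  rcases le_or_gt p (2 * t) with h1 | h1
  · exact ⟨t, ⟨ht, ht2⟩, le_rfl, hlt⟩
  · refine ⟨p / 2, ⟨by linarith [hp.1], by linarith [hp.2]⟩, by linarith, ?_⟩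
    rw [mul_div_cancel₀ _ two_ne_zero, relEntropy_self]
    linarith

/-! ### Binomial estimates -/

/-- The probability that exactly `k` of `n` coins of bias `x` show the biased side. -/
def binomialTerm (n : ℕ) (x : ℝ) (k : ℕ) : ℝ := n.choose k * (x ^ k * (1 - x) ^ (n - k))

theorem sum_binomialTerm (n : ℕ) (x : ℝ) : ∑ k ∈ Finset.range (n + 1), binomialTerm n x k = 1 := by
  have := add_pow x (1 - x) n
  rw [add_sub_cancel, one_pow] at this
  rw [this]
  exact Finset.sum_congr rfl fun k _ => mul_comm _ _

theorem binomialTerm_nonneg (n : ℕ) {x : ℝ} (h0 : 0 ≤ x) (h1 : x ≤ 1) (k : ℕ) :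
    0 ≤ binomialTerm n x k := by
  have : 0 ≤ 1 - x := by linarith
  unfold binomialTerm
  positivity

theorem binomialTerm_le_one (n : ℕ) {x : ℝ} (h0 : 0 ≤ x) (h1 : x ≤ 1) (k : ℕ) :
    binomialTerm n x k ≤ 1 := by
  rcases le_or_gt k n with hk | hk
  · rw [← sum_binomialTerm n x]
    exact Finset.single_le_sum (f := binomialTerm n x)
      (fun i _ => binomialTerm_nonneg n h0 h1 i) (Finset.mem_range.2 (by omega))
  · simp [binomialTerm, Nat.choose_eq_zero_of_lt hk]

theorem binomialTerm_succ {n k : ℕ} (x : ℝ) (hk : k < n) :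
    binomialTerm n x (k + 1) * ((k + 1) * (1 - x)) = binomialTerm n x k * ((n - k) * x) := by
  have h : (n.choose (k + 1) : ℝ) * (k + 1) = n.choose k * (n - k) := by
    have := Nat.choose_succ_right_eq n k
    rw [← Nat.cast_sub hk.le]
    exact_mod_cast this
  unfold binomialTerm
  rw [show n - k = n - (k + 1) + 1 by omega, pow_succ, pow_succ]
  linear_combination (x ^ k * x * (1 - x) ^ (n - (k + 1)) * (1 - x)) * h

/-- The largest term of the binomial distribution with mean `m`. -/
theorem binomialTerm_le_of_mean {n m : ℕ} (h0 : 0 < m) (h1 : m < n) {k : ℕ} (hk : k ≤ n) :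
    binomialTerm n (m / n) k ≤ binomialTerm n (m / n) m := by
  have hn : (0 : ℝ) < n := by exact_mod_cast h0.trans h1
  set x : ℝ := m / n with hx
  have hnx : n * x = m := by rw [hx]; field_simp
  have hx0 : 0 < x := div_pos (by exact_mod_cast h0) hn
  have hx1 : x < 1 := (div_lt_one hn).2 (by exact_mod_cast h1)
  have hT := binomialTerm_nonneg n hx0.le hx1.le
  -- The ratio of term `k + 1` to term `k` is at least 1 exactly when `k + 1 ≤ m + x`; as `0 < x <
  -- 1`, the terms rise up to `m` and fall afterwards.
  rcases le_total k m with h | h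
  · induction h using Nat.decreasingInduction with
    | self => exact le_rfl
    | of_succ k hkm ih =>
      refine le_trans ?_ (ih (by omega))
      have hpos : 0 < ((k : ℝ) + 1) * (1 - x) := mul_pos (by positivity) (by linarith)
      refine le_of_mul_le_mul_right ?_ hpos
      rw [binomialTerm_succ x (by omega)]
      refine mul_le_mul_of_nonneg_left ?_ (hT k)
      have : (k : ℝ) + 1 ≤ m := by exact_mod_cast hkm
      nlinarith
  · induction k, h using Nat.le_induction with
    | base => exact le_rfl
    | succ k hkm ih =>
      refine le_trans ?_ (ih (by omega))
      have hpos : 0 < ((k : ℝ) + 1) * (1 - x) := mul_pos (by positivity) (by linarith)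
      refine le_of_mul_le_mul_right ?_ hpos
      rw [binomialTerm_succ x (by omega)]
      refine mul_le_mul_of_nonneg_left ?_ (hT k)
      have : (m : ℝ) ≤ k := by exact_mod_cast hkm
      nlinarith

/-- Change of measure from bias `m / n` to bias `p`, for one sequence with exactly `m` successes. -/
theorem exp_neg_relEntropy {p : ℝ} (hp : p ∈ Set.Ioo (0 : ℝ) 1) {n m : ℕ} (h0 : 0 < m)
    (h1 : m < n) :
    Real.exp (-(n * relEntropy p (m / n))) * ((m / n : ℝ) ^ m * (1 - m / n) ^ (n - m)) =
      p ^ m * (1 - p) ^ (n - m) := by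
  have hn : (0 : ℝ) < n := by exact_mod_cast h0.trans h1
  set x : ℝ := m / n with hx
  have hnx : n * x = m := by rw [hx]; field_simp
  have hx0 : 0 < x := div_pos (by exact_mod_cast h0) hn
  have hx1 : 0 < 1 - x := sub_pos.2 ((div_lt_one hn).2 (by exact_mod_cast h1))
  have hp1 : 0 < 1 - p := by linarith [hp.2]
  have key : ∀ y : ℝ, 0 < y → ∀ k : ℕ, y ^ k = Real.exp (k * Real.log y) := fun y hy k => by
    rw [Real.exp_nat_mul, Real.exp_log hy]
  rw [key x hx0, key _ hx1, key p hp.1, key _ hp1, ← Real.exp_add, ← Real.exp_add, ← Real.exp_add,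
    Nat.cast_sub h1.le, ← hnx, relEntropy]
  congr 1
  ring

/-- At bias `m / n` the term at `m` is the largest of `n + 1` terms with sum 1, hence at least `1 /
(n + 1)`; then the measure is changed. -/
theorem exp_neg_relEntropy_le_binomialTerm {p : ℝ} (hp : p ∈ Set.Ioo (0 : ℝ) 1) {n m : ℕ}
    (h0 : 0 < m) (h1 : m < n) :
    Real.exp (-(n * relEntropy p (m / n))) ≤ (n + 1) * binomialTerm n p m := by
  have h : (1 : ℝ) ≤ (n + 1) * binomialTerm n (m / n) m := by
    have := Finset.sum_le_card_nsmul (Finset.range (n + 1)) (binomialTerm n (m / n))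
      (binomialTerm n (m / n) m) fun k hk =>
        binomialTerm_le_of_mean h0 h1 (Nat.lt_succ_iff.1 (Finset.mem_range.1 hk))
    rw [sum_binomialTerm, Finset.card_range, nsmul_eq_mul] at this
    exact_mod_cast this
  have h2 := mul_le_mul_of_nonneg_left h (Real.exp_nonneg (-(n * relEntropy p (m / n))))
  rw [mul_one] at h2
  refine h2.trans_eq ?_
  rw [binomialTerm, binomialTerm, ← exp_neg_relEntropy hp h0 h1]
  ring

/-- The optimal exponential Markov bound. -/
theorem exists_markov_bound {p t : ℝ} (hp : p ∈ Set.Ioo (0 : ℝ) 1) (ht : 0 < t) (htp : t < p)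
    (n : ℕ) : ∃ l : ℝ, 0 < l ∧ l ≤ 1 ∧
      l ^ (-(t * n)) * (p * l + (1 - p)) ^ n = Real.exp (-(n * relEntropy p t)) := by
  have hp1 : 0 < 1 - p := by linarith [hp.2]
  have ht1 : 0 < 1 - t := by linarith [hp.2]
  have hp0 := hp.1
  have hl : 0 < t * (1 - p) / ((1 - t) * p) := by positivity
  -- The weight `l` that tilts the bias `p` to `t`, namely `p * l / (p * l + 1 - p) = t`; it is at
  -- most 1 because `t < p`.
  refine ⟨t * (1 - p) / ((1 - t) * p), hl, (div_le_one (by positivity)).2 (by nlinarith), ?_⟩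
  have h1 : p * (t * (1 - p) / ((1 - t) * p)) + (1 - p) = (1 - p) / (1 - t) := by
    field_simp
    ring
  rw [h1, Real.rpow_def_of_pos hl, ← Real.exp_log (div_pos hp1 ht1), ← Real.exp_nat_mul,
    ← Real.exp_add, Real.log_div (by positivity) (by positivity),
    Real.log_mul (by positivity) (by positivity), Real.log_mul (by positivity) (by positivity),
    Real.log_div (by positivity) (by positivity), relEntropy]
  congr 1
  ring

/-! ### The choice of the scale -/

open Filter Topology

theorem tendsto_ceil_div {s : ℝ} (hs : 0 ≤ s) (hs1 : s ≤ 1) :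
    Tendsto (fun w : ℕ => (⌈s * (2 * (w : ℝ) + 1)⌉₊ : ℝ) / ((w + 1 : ℕ) : ℝ)) atTop
      (𝓝 (2 * s)) := by
  have h0 := tendsto_one_div_add_atTop_nhds_zero_nat (𝕜 := ℝ)
  have hlo : Tendsto (fun w : ℕ => 2 * s - 1 / ((w : ℝ) + 1)) atTop (𝓝 (2 * s)) := by
    simpa using tendsto_const_nhds.sub h0
  have hhi : Tendsto (fun w : ℕ => 2 * s + 1 / ((w : ℝ) + 1)) atTop (𝓝 (2 * s)) := by
    simpa using tendsto_const_nhds.add h0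
  refine tendsto_of_tendsto_of_tendsto_of_le_of_le hlo hhi (fun w => ?_) fun w => ?_
  · have h1 := Nat.le_ceil (s * (2 * (w : ℝ) + 1))
    have hw : (0 : ℝ) < w + 1 := by positivity
    simp only
    push_cast
    rw [le_div_iff₀ hw, sub_mul, one_div_mul_cancel hw.ne']
    linarith
  · have h1 := Nat.ceil_lt_add_one (a := s * (2 * (w : ℝ) + 1)) (by positivity)
    have hw : (0 : ℝ) < w + 1 := by positivity
    simp only
    push_cast
    rw [div_le_iff₀ hw, add_mul, one_div_mul_cancel hw.ne']
    linarith

theorem tendsto_pow_mul_exp_neg {g : ℝ} (hg : 0 < g) (C : ℝ) :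
    Tendsto (fun w : ℕ => C * (((w : ℝ) + 2) ^ 3 * Real.exp (-(g * w)))) atTop (𝓝 0) := by
  have h1 : Tendsto (fun w : ℕ => g * ((w : ℝ) + 2)) atTop atTop :=
    (tendsto_atTop_add_const_right _ _ tendsto_natCast_atTop_atTop).const_mul_atTop hg
  have h2 := ((Real.tendsto_pow_mul_exp_neg_atTop_nhds_zero 3).comp h1).const_mul
    (C * Real.exp (2 * g) / g ^ 3)
  rw [mul_zero] at h2
  refine h2.congr fun w => ?_
  simp only [Function.comp]
  rw [show -(g * (w : ℝ)) = 2 * g + -(g * (w + 2)) by ring, Real.exp_add]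
  field_simp

/-- For large `w` there is a number `M` of blocks such that some block is stable on either side,
and all nodes in these blocks are happy, with high probability. -/
theorem exists_number_of_blocks {p t : ℝ} (hp : p ∈ Set.Ioo (0 : ℝ) 1) (ht : 0 < t)
    (h : t < kappaG p) {ε : ℝ} (hε : 0 < ε) :
    ∃ W : ℕ, ∀ w : ℕ, W ≤ w → ∃ m M : ℕ, t * (2 * (w : ℝ) + 1) ≤ m ∧
      2 * (1 - binomialTerm (w + 1) p m) ^ M + (2 * (M * ((w : ℝ) + 1)) + 1) *
        Real.exp (-((2 * w + 1 : ℕ) * relEntropy p t)) ≤ ε := by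
  obtain ⟨htp, s, hs, hts, hlt⟩ := exists_relEntropy_lt hp ht h
  have hD : 0 ≤ relEntropy p t := relEntropy_nonneg hp ⟨ht, htp.trans hp.2⟩
  -- The gap up to `A` absorbs the rounding of the density to `m / (w + 1)`; the gap above `A` beats
  -- the polynomial factors.
  obtain ⟨A, hA1, hA2⟩ := exists_between hlt
  have hlim := tendsto_ceil_div hs.1.le (by linarith [hs.2])
  have e1 := ((continuous_relEntropy p).tendsto _).comp hlim |>.eventually (gt_mem_nhds hA1)
  have e2 := hlim.eventually (lt_mem_nhds (show (0 : ℝ) < 2 * s by linarith [hs.1]))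
  have e3 := hlim.eventually (gt_mem_nhds (show 2 * s < (1 : ℝ) by linarith [hs.2]))
  have e4 := (tendsto_pow_mul_exp_neg (show 0 < 2 * relEntropy p t - A by linarith)
    (3 * Real.exp A)).eventually (gt_mem_nhds (half_pos hε))
  have e5 := (tendsto_pow_mul_exp_neg one_pos 2).eventually (gt_mem_nhds (half_pos hε))
  obtain ⟨W, hW⟩ := eventually_atTop.1 (e1.and (e2.and (e3.and (e4.and e5))))
  refine ⟨W, fun w hw => ?_⟩
  obtain ⟨h1, h2, h3, h4, h5⟩ := hW w hw
  set m := ⌈s * (2 * (w : ℝ) + 1)⌉₊ with hm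
  set q := binomialTerm (w + 1) p m with hq
  have hw1 : (0 : ℝ) < ((w + 1 : ℕ) : ℝ) := by positivity
  have hm0 : 0 < m := by
    rw [lt_div_iff₀ hw1, zero_mul] at h2
    exact_mod_cast h2
  have hm1 : m < w + 1 := by
    rw [div_lt_one hw1] at h3
    exact_mod_cast h3
  have hq1 : q ≤ 1 := binomialTerm_le_one _ hp.1.le hp.2.le _
  have hqlow : Real.exp (-(((w : ℝ) + 1) * A)) ≤ (w + 2) * q := by
    have := exp_neg_relEntropy_le_binomialTerm hp hm0 hm1
    refine le_trans (Real.exp_le_exp.2 ?_) (this.trans_eq ?_)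
    · push_cast at h1 ⊢
      simp only [Function.comp] at h1
      exact neg_le_neg (mul_le_mul_of_nonneg_left h1.le (by positivity))
    · push_cast
      ring
  have hq0 : 0 < q := by
    have : 0 < ((w : ℝ) + 2) * q := (Real.exp_pos _).trans_le hqlow
    exact pos_of_mul_pos_right this (by positivity)
  set r := Real.exp (-((2 * w + 1 : ℕ) * relEntropy p t)) with hr
  -- The decisive comparison: unhappy nodes (`r`) are exponentially rarer than stable blocks (`q`).
  have hrq : r / q ≤ Real.exp A * ((w + 2) * Real.exp (-((2 * relEntropy p t - A) * w))) := by
    rw [div_le_iff₀ hq0]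
    calc r ≤ Real.exp A * Real.exp (-((2 * relEntropy p t - A) * w)) *
          Real.exp (-(((w : ℝ) + 1) * A)) := by
          rw [hr, ← Real.exp_add, ← Real.exp_add, Real.exp_le_exp]
          push_cast
          linarith
      _ ≤ Real.exp A * Real.exp (-((2 * relEntropy p t - A) * w)) * ((w + 2) * q) := by
          gcongr
      _ = _ := by ring
  -- About `w / q` blocks: then `(1 - q) ^ M ≤ exp (-w)`, while the expected number of unhappy nodes
  -- met is of order `w ^ 2 * r / q`.
  refine ⟨m, ⌈(w : ℝ) / q⌉₊, ?_, ?_⟩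
  · exact (mul_le_mul_of_nonneg_right hts (by positivity)).trans (Nat.le_ceil _)
  set M := ⌈(w : ℝ) / q⌉₊ with hM
  have b1 : (1 - q) ^ M ≤ Real.exp (-(1 * w)) := by
    calc (1 - q) ^ M ≤ Real.exp (-q) ^ M :=
          pow_le_pow_left₀ (by linarith) (Real.one_sub_le_exp_neg q) M
      _ = Real.exp (-(M * q)) := by rw [← Real.exp_nat_mul, mul_neg]
      _ ≤ _ := by
          rw [Real.exp_le_exp, one_mul, neg_le_neg_iff, ← div_le_iff₀ hq0]
          exact Nat.le_ceil _
  have b2 : 2 * (1 - q) ^ M ≤ ε / 2 := by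
    refine le_trans ?_ h5.le
    gcongr
    refine b1.trans (le_mul_of_one_le_left (Real.exp_nonneg _) (one_le_pow₀ ?_))
    have : (0 : ℝ) ≤ w := w.cast_nonneg
    linarith
  have b3 : (M : ℝ) ≤ (w + 1) / q := by
    have := (Nat.ceil_lt_add_one (a := (w : ℝ) / q) (by positivity)).le
    refine this.trans ?_
    rw [add_div]
    gcongr
    exact (one_le_div hq0).2 hq1
  have b4 : (2 * (M * ((w : ℝ) + 1)) + 1) * r ≤ ε / 2 := by
    refine le_trans ?_ h4.le
    calc (2 * (M * ((w : ℝ) + 1)) + 1) * r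
        ≤ (2 * ((w + 1) / q * ((w : ℝ) + 1)) + 1 / q) * r := by
          gcongr
          exact (one_le_div hq0).2 hq1
      _ = (2 * ((w : ℝ) + 1) ^ 2 + 1) * (r / q) := by ring
      _ ≤ (3 * ((w : ℝ) + 2) ^ 2) *
          (Real.exp A * ((w + 2) * Real.exp (-((2 * relEntropy p t - A) * w)))) := by
          gcongr
          have : (0 : ℝ) ≤ w := w.cast_nonneg
          nlinarith
      _ = _ := by ring
  linarith

/-! ### Bad initial colourings -/

theorem card_rightBlock {n w : ℕ} (u : ZMod n) (k : ℕ) (h : w < n) :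
    (rightBlock w u k).card = w + 1 := by
  rw [rightBlock, card_arc (by omega)]
  omega

theorem card_leftBlock {n w : ℕ} (u : ZMod n) (k : ℕ) (h : w < n) :
    (leftBlock w u k).card = w + 1 := by
  rw [leftBlock, card_arc (by omega)]
  omega

theorem disjoint_rightBlock {n w M : ℕ} (u : ZMod n) {k l : ℕ} (hk : k < M) (hl : l < k)
    (h : M * (w + 1) < n) : Disjoint (rightBlock w u l) (rightBlock w u k) := by
  have h1 : ((l : ℤ) + 1) * (w + 1) ≤ k * (w + 1) := by
    have : (l : ℤ) + 1 ≤ k := by exact_mod_cast hl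
    gcongr
  have h2 : ((k : ℤ) + 1) * (w + 1) ≤ M * (w + 1) := by
    have : (k : ℤ) + 1 ≤ M := by exact_mod_cast hk
    gcongr
  have h3 : (M : ℤ) * (w + 1) < n := by exact_mod_cast h
  have h4 : 0 ≤ (l : ℤ) * (w + 1) := by positivity
  exact disjoint_arc (by linarith) (by linarith)

theorem disjoint_leftBlock {n w M : ℕ} (u : ZMod n) {k l : ℕ} (hk : k < M) (hl : l < k)
    (h : M * (w + 1) < n) : Disjoint (leftBlock w u l) (leftBlock w u k) := by
  have h1 : ((l : ℤ) + 1) * (w + 1) ≤ k * (w + 1) := by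
    have : (l : ℤ) + 1 ≤ k := by exact_mod_cast hl
    gcongr
  have h2 : ((k : ℤ) + 1) * (w + 1) ≤ M * (w + 1) := by
    have : (k : ℤ) + 1 ≤ M := by exact_mod_cast hk
    gcongr
  have h3 : (M : ℤ) * (w + 1) < n := by exact_mod_cast h
  have h4 : 0 ≤ (l : ℤ) * (w + 1) := by positivity
  exact (disjoint_arc (by linarith) (by linarith)).symm

/-- The colourings for which the node `u` is not sheltered, with respect to the colour `γ`, by
`M` blocks on either side. -/
def Unsheltered {n : ℕ} (w : ℕ) (τg τr : ℝ) (γ : Colour) (m M : ℕ) (u : ZMod n) :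
    Set (Colouring n) :=
  {c | ∀ k < M, ¬ m ≤ count γ (rightBlock w u k) c} ∪
    {c | ∀ k < M, ¬ m ≤ count γ (leftBlock w u k) c} ∪
      ⋃ y ∈ arc u (-(M * (w + 1) : ℤ)) (M * (w + 1)), {c | c y = γ ∧ ¬ Happy w τg τr c y}

/-- Once `c y = γ` has turned unhappiness into a low count of `γ`, that condition is dropped,
leaving a tail event for `2 * w + 1` independent coins. -/
theorem measureReal_unhappy_le {n : ℕ} [NeZero n] {w : ℕ} {τg τr : ℝ} (ν : Measure Colour)
    [IsProbabilityMeasure ν] {γ : Colour} (hp : ν.real {γ} ∈ Set.Ioo (0 : ℝ) 1)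
    (ht : 0 < tolerance τg τr γ) (htp : tolerance τg τr γ < ν.real {γ}) (hn : 2 * w < n)
    (y : ZMod n) :
    (Measure.pi fun _ : ZMod n => ν).real {c | c y = γ ∧ ¬ Happy w τg τr c y} ≤
      Real.exp (-((2 * w + 1 : ℕ) * relEntropy (ν.real {γ}) (tolerance τg τr γ))) := by
  obtain ⟨l, hl0, hl1, hl⟩ := exists_markov_bound hp ht htp (2 * w + 1)
  have hcard : (neighbourhood w y).card = 2 * w + 1 := by
    change (arc y (-(w : ℤ)) w).card = _
    rw [card_arc (by omega)]
    omega
  rw [← hl]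
  have := measureReal_count_lt_le ν γ (neighbourhood w y)
    (tolerance τg τr γ * (2 * w + 1 : ℕ)) hl0 hl1
  rw [hcard] at this
  refine le_trans (measureReal_mono ?_) this
  rintro c ⟨hc, hh⟩
  rw [happy_iff_stable hc, Stable, not_le] at hh
  change (count γ (neighbourhood w y) c : ℝ) < _
  push_cast
  exact hh

/-- A union bound over the two sides and the nodes between. Only blocks on the same side need be
disjoint, so `M * (w + 1) < n` suffices even if left and right blocks overlap around the ring. -/
theorem measureReal_unsheltered_le {n : ℕ} [NeZero n] {w : ℕ} {τg τr : ℝ} (ν : Measure Colour)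
    [IsProbabilityMeasure ν] {γ : Colour} (hp : ν.real {γ} ∈ Set.Ioo (0 : ℝ) 1)
    (ht : 0 < tolerance τg τr γ) (htp : tolerance τg τr γ < ν.real {γ}) {m M : ℕ}
    (hn : 2 * w < n) (hM : M * (w + 1) < n) (u : ZMod n) :
    (Measure.pi fun _ : ZMod n => ν).real (Unsheltered w τg τr γ m M u) ≤
      2 * (1 - binomialTerm (w + 1) (ν.real {γ}) m) ^ M + (2 * (M * ((w : ℝ) + 1)) + 1) *
        Real.exp (-((2 * w + 1 : ℕ) * relEntropy (ν.real {γ}) (tolerance τg τr γ))) := by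
  have hq1 := binomialTerm_le_one (w + 1) hp.1.le hp.2.le m
  have hr := measureReal_forall_count_lt_le ν γ (rightBlock w u) m hq1 M
    (fun k hk l hl => disjoint_rightBlock u hk hl hM) fun k _ => by
      have := choose_mul_le_measureReal_count ν γ (rightBlock w u k) m
      rwa [card_rightBlock u k (by omega)] at this
  have hl := measureReal_forall_count_lt_le ν γ (leftBlock w u) m hq1 M
    (fun k hk l hl => disjoint_leftBlock u hk hl hM) fun k _ => by
      have := choose_mul_le_measureReal_count ν γ (leftBlock w u k) m
      rwa [card_leftBlock u k (by omega)] at this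
  have hcard : ((arc u (-(M * (w + 1) : ℤ)) (M * (w + 1))).card : ℝ) ≤
      2 * (M * ((w : ℝ) + 1)) + 1 := by
    have h1 : (arc u (-(M * (w + 1) : ℤ)) (M * (w + 1))).card ≤ 2 * (M * (w + 1)) + 1 := by
      refine Finset.card_image_le.trans ?_
      rw [Int.card_Icc, Int.toNat_le]
      push_cast
      linarith
    exact_mod_cast h1
  have hmid : (Measure.pi fun _ : ZMod n => ν).real
      (⋃ y ∈ arc u (-(M * (w + 1) : ℤ)) (M * (w + 1)), {c | c y = γ ∧ ¬ Happy w τg τr c y}) ≤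
        (2 * (M * ((w : ℝ) + 1)) + 1) *
          Real.exp (-((2 * w + 1 : ℕ) * relEntropy (ν.real {γ}) (tolerance τg τr γ))) := by
    refine (measureReal_biUnion_finset_le _ _).trans ?_
    refine (Finset.sum_le_card_nsmul _ _ _ fun y _ =>
      measureReal_unhappy_le ν hp ht htp hn y).trans ?_
    rw [nsmul_eq_mul]
    gcongr
  refine (measureReal_union_le _ _).trans ?_
  have := measureReal_union_le (μ := Measure.pi fun _ : ZMod n => ν)
    {c | ∀ k < M, ¬ m ≤ count γ (rightBlock w u k) c}
    {c | ∀ k < M, ¬ m ≤ count γ (leftBlock w u k) c}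
  linarith

theorem colour_eq_of_sheltered {n w : ℕ} {τg τr : ℝ} {c : ℕ → Colouring n}
    (hc : ∀ t y, c (t + 1) y ≠ c t y → ¬ Happy w τg τr (c t) y) {u : ZMod n} {m M : ℕ}
    (hm : tolerance τg τr (c 0 u) * (2 * (w : ℝ) + 1) ≤ m)
    (hu : c 0 ∉ Unsheltered w τg τr (c 0 u) m M u) (t : ℕ) : c t u = c 0 u := by
  simp only [Unsheltered, Set.mem_union, Set.mem_ofPred_eq, Set.mem_iUnion, not_or, not_forall,
    not_not, not_exists, not_and] at hu
  obtain ⟨⟨⟨k, hk, hks⟩, l, hl, hls⟩, hmid⟩ := hu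
  exact colour_eq_of_blocks hc ⟨k, hk, hm.trans (Nat.cast_le.2 hks)⟩
    ⟨l, hl, hm.trans (Nat.cast_le.2 hls)⟩ (fun y hy h => hmid y hy h) t

theorem coin_real_green {ρ : ℝ} (h0 : 0 ≤ ρ) : (coin ρ).real {green} = ρ := by
  simp [coin, measureReal_def, h0]

theorem coin_real_red {ρ : ℝ} (h1 : ρ ≤ 1) : (coin ρ).real {red} = 1 - ρ := by
  simp [coin, measureReal_def, h1]

end Schelling

end

/-! ### Both colours together: the scenario is static almost everywhere -/

theorem mainTheorem1 (d : Schelling.Dynamics) (ρ τg τr : ℝ)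
    (hρ : ρ ∈ Set.Ioo (0 : ℝ) 1) (hτg : τg ∈ Set.Ioo (0 : ℝ) 1) (hτr : τr ∈ Set.Ioo (0 : ℝ) 1)
    (hg : τg < Schelling.kappaG ρ) (hr : τr < Schelling.kappaR ρ) :
    Schelling.StaticAlmostEverywhere d ρ τg τr := by
  open Schelling in
  intro ε hε
  have hν := isProbabilityMeasure_coin hρ.1.le hρ.2.le
  have hp : ∀ γ, (coin ρ).real {γ} ∈ Set.Ioo (0 : ℝ) 1 := by
    rintro (_ | _)
    · rw [coin_real_red hρ.2.le]
      exact ⟨by linarith [hρ.2], by linarith [hρ.1]⟩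
    · rwa [coin_real_green hρ.1.le]
  have ht : ∀ γ, 0 < tolerance τg τr γ := by
    rintro (_ | _)
    exacts [hτr.1, hτg.1]
  -- By the symmetry `kappaR_eq`, both colours fall under the green threshold, taken at the colour's
  -- own probability.
  have hk : ∀ γ, tolerance τg τr γ < kappaG ((coin ρ).real {γ}) := by
    rintro (_ | _)
    · rwa [coin_real_red hρ.2.le, ← kappaR_eq]
    · rwa [coin_real_green hρ.1.le]
  choose W hW using fun γ => exists_number_of_blocks (hp γ) (ht γ) (hk γ)
    (show 0 < ε / 4 by linarith)
  refine ⟨max (W green) (W red), fun w hw => ?_⟩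
  have hWw : ∀ γ, W γ ≤ w := by
    rintro (_ | _)
    exacts [(le_max_right _ _).trans hw, (le_max_left _ _).trans hw]
  choose m M hm hM using fun γ => hW γ w (hWw γ)
  refine ⟨2 * w + 1 + (M green * (w + 1) + M red * (w + 1)), fun n _ hn => ?_⟩
  have hMn : ∀ γ, M γ * (w + 1) < n := by
    rintro (_ | _)
    · exact lt_of_lt_of_le (by change M red * (w + 1) < _; omega) hn
    · exact lt_of_lt_of_le (by change M green * (w + 1) < _; omega) hn
  have : IsProbabilityMeasure (initialLaw n ρ) := by
    unfold initialLaw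
    infer_instance
  -- The initial colour of `u` is random, so the bad event is the union over both colours; `ε / 4`
  -- for each leaves room for strict inequality.
  refine lt_of_le_of_lt (nodeAndProcessLaw_changesColour_le (δ := ENNReal.ofReal (ε / 2))
    (fun u => ⋃ γ, Unsheltered w τg τr γ (m γ) (M γ) u) (fun u => ?_) fun u c hc hu t => ?_)
    ((ENNReal.ofReal_lt_ofReal_iff hε).2 (by linarith))
  · rw [← ofReal_measureReal]
    refine ENNReal.ofReal_le_ofReal ((measureReal_iUnion_fintype_le _).trans ?_)
    have hb : ∀ γ, (initialLaw n ρ).real (Unsheltered w τg τr γ (m γ) (M γ) u) ≤ ε / 4 :=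
      fun γ => (measureReal_unsheltered_le (coin ρ) (hp γ) (ht γ)
        (exists_relEntropy_lt (hp γ) (ht γ) (hk γ)).1 (by omega) (hMn γ) u).trans (hM γ)
    rw [Fintype.sum_bool]
    linarith [hb true, hb false]
  · rw [Set.mem_iUnion, not_exists] at hu
    exact colour_eq_of_sheltered hc (hm _) (hu _) t
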